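/- Let $D([0,1])$ be the set of functions $x:[0,1]\to\mathbb{R}$ that are right-continuous and have left limits (with the convention $x(0-)=x(0)$). **The $S$ topology.** Let $V([0,1])\subset D([0,1])$ be the set of elements of finite variation. For $v\in V([0,1])$ let $dv$ be the finite signed measure on $[0,1]$ with $dv([0,t])=v(t)$ for all $t$, and write $v_n\Rightarrow v_0$ if $\int_{[0,1]} f\,dv_n\to\int_{[0,1]} f\,dv_0$ for every continuous $f:[0,1]\to\mathbb{R}$. A sequence $x_n$ *$S$-converges* to $x_0$ ($x_n\to_S x_0$) if for every $\varepsilon>0$ there are $v_{n,\varepsilon}\in V([0,1])$, $n=0,1,2,\dots$, with $\|x_n-v_{n,\varepsilon}\|_\infty\le\varepsilon$ for all $n\ge 0$ and $v_{n,\varepsilon}\Rightarrow v_{0,\varepsilon}$ as $n\to\infty$. The $S$ topology is the sequential topology determined by this convergence: $U$ is open iff every sequence that $S$-converges to a point of $U$ is eventually in $U$. **The $M_1$ and $J_1$ topologies.** The completed graph of $x$ is the set $\Gamma_x$ of the pairs $(z,t)\in\mathbb{R}\times[0,1]$ with $z$ between $x(t-)$ and $x(t)$, ordered first by $t$ and,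 for equal $t$, by $|z-x(t-)|$. A parametric representation of $x$ is a continuous nondecreasing map $(u,r)$ of $[0,1]$ onto $\Gamma_x$. The $M_1$ topology is the topology of the distance $$d_{M_1}(x,y)=\inf\max\big(\|u-w\|_\infty,\|r-q\|_\infty\big),$$ the infimum being over all parametric representations $(u,r)$ of $x$ and $(w,q)$ of $y$. The $J_1$ topology is the topology of the distance $d_{J_1}(x,y)=\inf_\lambda\max\big(\sup_t|\lambda(t)-t|,\ \sup_t|x(t)-y(\lambda(t))|\big)$, the infimum being over all increasing bijections $\lambda$ of $[0,1]$. **Theorem.** The $S$ topology on $D([0,1])$ is weaker (coarser, not necessarily strictly) than the $M_1$ topology, and hence weaker than the $J_1$ topology: every $S$-open set is $M_1$-open and $J_1$-open. Consequently every relatively $M_1$-compact set $A\subset D([0,1])$ is relatively $S$-compact, both in the topological and in the sequential sense: 1. if the $M_1$-closure of $A$ is $M_1$-compact, then the $S$-closure of $A$ is $S$-compact; 2. if every sequence in $A$ has a subsequence that converges to some element of $D([0,1])$ for $d_{M_1}$, then every sequence in $A$ has a subsequence $x_{n_k}$ with $x_{n_k}\to_S x_0$ for some $x_0\in D([0,1])$.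 -/

import Mathlib

open Set Filter Topology MeasureTheory
open scoped unitInterval ENNReal

noncomputable section

/-- The Skorokhod space `D([0,1])`: real functions on `[0,1]` which are right-continuous at every
point and have a left limit at every point (both conditions are void at the endpoint where the
corresponding one-sided neighbourhood is trivial). -/
@[ext]
structure SkorokhodSpace where
  toFun : I → ℝ
  rightContinuous : ∀ t, ContinuousWithinAt toFun (Ici t) t
  exists_leftLim : ∀ t, ∃ l, Tendsto toFun (𝓝[<] t) (𝓝 l)

namespace SkorokhodSpace

instance : CoeFun SkorokhodSpace (fun _ => I → ℝ) := ⟨toFun⟩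

/-- The topology of a distance function: `U` is open if it contains, around each of its points,
a ball of positive radius. -/
abbrev topologyOfDist {X : Type*} (d : X → X → ℝ≥0∞) : TopologicalSpace X where
  IsOpen U := ∀ x ∈ U, ∃ ε > 0, ∀ y, d x y < ε → y ∈ U
  isOpen_univ := fun _ _ => ⟨1, one_pos, fun _ _ => mem_univ _⟩
  isOpen_inter := by
    rintro U V hU hV x ⟨hxU, hxV⟩
    obtain ⟨a, ha, hUa⟩ := hU x hxU
    obtain ⟨b, hb, hVb⟩ := hV x hxV
    exact ⟨min a b, lt_min ha hb, fun y hy =>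
      ⟨hUa y (hy.trans_le (min_le_left _ _)), hVb y (hy.trans_le (min_le_right _ _))⟩⟩
  isOpen_sUnion := by
    rintro S hS x ⟨U, hU, hx⟩
    obtain ⟨ε, hε, h⟩ := hS U hU x hx
    exact ⟨ε, hε, fun y hy => ⟨U, hU, h y hy⟩⟩

/-! ### The `J₁` topology -/

/-- Skorokhod's `J₁` distance: the infimum over increasing bijections `l` of `[0,1]` of
`max (sup |l t - t|) (sup |x t - y (l t)|)`. -/
def j1Dist (x y : SkorokhodSpace) : ℝ≥0∞ :=
  ⨅ l : I ≃o I, max (⨆ t, edist (l t) t) (⨆ t, edist (x t) (y (l t)))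

abbrev j1Topology : TopologicalSpace SkorokhodSpace := topologyOfDist j1Dist

/-! ### The `M₁` topology -/

/-- The completed graph of `x`: all pairs `(z, t)` with `z` between `x (t-)` and `x t`, where
`x (0-) = x 0`. -/
def completedGraph (x : SkorokhodSpace) : Set (ℝ × I) :=
  {p | p.1 ∈ uIcc (Function.leftLim x p.2) (x p.2)}

/-- The order on the completed graph: first by time, and at the same time `t` by the distance
from `x (t-)`. -/
def graphLE (x : SkorokhodSpace) (p q : ℝ × I) : Prop :=
  p.2 < q.2 ∨
    (p.2 = q.2 ∧ |p.1 - Function.leftLim x p.2| ≤ |q.1 - Function.leftLim x p.2|)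

/-- Parametric representations of `x`: continuous nondecreasing maps of `[0,1]` onto the completed
graph of `x`. -/
def parametricReps (x : SkorokhodSpace) : Set (I → ℝ × I) :=
  {φ | Continuous φ ∧ range φ = completedGraph x ∧ ∀ s s', s ≤ s' → graphLE x (φ s) (φ s')}

/-- Skorokhod's `M₁` distance: the infimum over parametric representations `φ = (u, r)` of `x` and
`ψ = (w, q)` of `y` of `max (sup |u - w|) (sup |r - q|)`; the distance on `ℝ × [0,1]` is the
maximum of the distances of the coordinates. -/
def m1Dist (x y : SkorokhodSpace) : ℝ≥0∞ :=
  ⨅ φ ∈ parametricReps x, ⨅ ψ ∈ parametricReps y, ⨆ s, edist (φ s) (ψ s)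

abbrev m1Topology : TopologicalSpace SkorokhodSpace := topologyOfDist m1Dist

/-- Convergence of a sequence for the `M₁` distance. -/
def M1Conv (x : ℕ → SkorokhodSpace) (x₀ : SkorokhodSpace) : Prop :=
  Tendsto (fun n => m1Dist (x n) x₀) atTop (𝓝 0)

/-! ### The `S` topology -/

/-- `V([0,1])`: the elements of `D([0,1])` of finite variation. -/
structure FiniteVariation extends SkorokhodSpace where
  boundedVariation : BoundedVariationOn toFun univ

/-- The signed measure `dv` on `[0,1]` given by `v ∈ V([0,1])`, with mass `v 0` at `0`, so that
`dv [0,t] = v t`. -/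
def FiniteVariation.measure (v : FiniteVariation) : SignedMeasure I :=
  VectorMeasure.dirac 0 (v.toFun 0) + v.boundedVariation.vectorMeasure

theorem FiniteVariation.measure_Iic (v : FiniteVariation) (t : I) :
    v.measure (Iic t) = v.toFun t := by
  have hb : IsBot (0 : I) := fun _ => unitInterval.nonneg'
  have hI : Iic t = Icc 0 t := Set.ext fun s => ⟨fun h => ⟨hb s, h⟩, fun h => h.2⟩
  have hr : Function.rightLim v.toFun t = v.toFun t :=
    (v.rightContinuous t).rightLim_eq
  have h0 : Function.leftLim v.toFun 0 = v.toFun 0 := leftLim_eq_of_isBot hb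
  have h1 : v.boundedVariation.vectorMeasure (Icc 0 t) = v.toFun t - v.toFun 0 := by
    rw [v.boundedVariation.vectorMeasure_Icc (hb t), hr, h0]
  have h2 : VectorMeasure.dirac (0 : I) (v.toFun 0) (Icc 0 t) = v.toFun 0 :=
    VectorMeasure.dirac_apply_of_mem measurableSet_Icc ⟨le_rfl, hb t⟩
  rw [FiniteVariation.measure, add_apply, hI, h1, h2]
  ring

/-- The integral over `[0,1]` of a continuous `f` with respect to `dv`. -/
def FiniteVariation.integral (v : FiniteVariation) (f : C(I, ℝ)) : ℝ :=
  ∫ᵛ t, f t ∂•v.measure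

/-- Weak-* convergence `v n ⇒ v₀` in `V([0,1])`. -/
def FiniteVariation.WeakStarConv (v : ℕ → FiniteVariation) (v₀ : FiniteVariation) : Prop :=
  ∀ f : C(I, ℝ), Tendsto (fun n => (v n).integral f) atTop (𝓝 (v₀.integral f))

/-- `S`-convergence of a sequence: for every `ε > 0` there are functions of finite variation which
are `ε`-uniformly close to the given ones and converge weakly-*. -/
def SConv (x : ℕ → SkorokhodSpace) (x₀ : SkorokhodSpace) : Prop :=
  ∀ ε : ℝ, 0 < ε → ∃ (v : ℕ → FiniteVariation) (v₀ : FiniteVariation),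
    (∀ n t, |x n t - (v n).toFun t| ≤ ε) ∧ (∀ t, |x₀ t - v₀.toFun t| ≤ ε) ∧
    FiniteVariation.WeakStarConv v v₀

/-- The `S` topology, the sequential topology determined by `S`-convergence: `U` is open if every
sequence which `S`-converges to a point of `U` is eventually in `U`. -/
abbrev sTopology : TopologicalSpace SkorokhodSpace where
  IsOpen U := ∀ x x₀, SConv x x₀ → x₀ ∈ U → ∀ᶠ n in atTop, x n ∈ U
  isOpen_univ := by simp
  isOpen_inter := fun _ _ hU hV x x₀ h h₀ =>
    (hU x x₀ h h₀.1).and (hV x x₀ h h₀.2)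
  isOpen_sUnion := by
    rintro S hS x x₀ h ⟨U, hU, h₀⟩
    exact (hS U hU x x₀ h h₀).mono fun n hn => ⟨U, hU, hn⟩

/-! ### Relative compactness -/

/-- `A` has compact closure in the topology `τ`. -/
def IsRelCompact (τ : TopologicalSpace SkorokhodSpace) (A : Set SkorokhodSpace) : Prop :=
  @IsCompact _ τ (@closure _ τ A)

/-- `A` is relatively compact with respect to a notion of convergence of sequences: every sequence
in `A` has a subsequence which converges to an element of `D([0,1])`. -/
def IsRelSeqCompact (conv : (ℕ → SkorokhodSpace) → SkorokhodSpace → Prop)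
    (A : Set SkorokhodSpace) : Prop :=
  ∀ x : ℕ → SkorokhodSpace, (∀ n, x n ∈ A) →
    ∃ k : ℕ → ℕ, StrictMono k ∧ ∃ x₀, conv (fun n => x (k n)) x₀

end SkorokhodSpace

end

/-!
The proof rests on one criterion for `S`-convergence, `sConv_of_tendsto_shadowDist`, which is
implied by convergence in either Skorokhod distance.

Let `x` be in `D([0,1])`. A *graph path* of `x` is a right-continuous nondecreasing path
`P : [0,1] → Γ_x` in the completed graph of `x` which ends at `(x 1, 1)`, and `shadowDist x y` is
the infimum over `P` of the uniform distance between `P` and `t ↦ (y t, t)`. An increasing bijection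
`l` gives the graph path `t ↦ (x (l⁻¹ t), l⁻¹ t)`, so `shadowDist ≤ j1Dist`. Given parametric
representations `ψ` of `x` and `φ` of `y`, let `s t` be the last parameter at which `φ` is at time
at most `t`; then `φ (s t) = (y t, t)`, and `ψ ∘ s` is a graph path of `x`, so
`shadowDist ≤ m1Dist`.

For every `ε > 0` there is a function `G` on the completed graph of `x` with `|G (z, t) - z| ≤ ε`
which is a difference of two functions that are nondecreasing along the graph and that depend,
away from finitely many times, only on the time and in a locally constant manner
(`exists_isGraphBV_approx`): cut `[0,1]` at finitely many times between which `x` oscillates by at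
most `ε`, let `G` be constant between them, and let it follow the graph through the jumps at them.
If `P n` are graph paths of `x` that get uniformly close to the graphs of `y n`, then
`v n = G ∘ P n` has finite variation and is eventually uniformly close to `y n`. The two monotone
parts of `v n` are distribution functions of measures whose total mass does not depend on `n`. They
converge outside a finite set, so the measures converge weakly (`tendsto_integral_of_tendsto_cdf`).
Hence `v n ⇒ v₀ = G (x ·, ·)`, and `y n` is `S`-convergent to `x`.

For the compactness statements, limits of `S`-convergent sequences are unique (`SConv.unique`),
since a bound on `v n - w n` passes to the weak-* limits. This makes `S`-compact sets `K` closed: if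
`y n ∈ K` converges to `z`, then the closed sets `{z} ∪ {y n | n ≥ N}` all meet `K`, hence they have
a common point in `K`. It is `z`, as any other common point would be a value which the sequence
takes infinitely often, and therefore a second limit of a subsequence. So the `M₁`-closure of `A`, being
`S`-compact, is `S`-closed and contains the `S`-closure of `A`.
-/

open Set Filter Topology MeasureTheory
open scoped unitInterval ENNReal

namespace SkorokhodSpace

/-! ### Distribution functions of measures on `[0,1]` -/

theorem setOf_coe_le_eq_Iic {u : ℝ} (hu : u ∈ Icc (0 : ℝ) 1) :
    {t : I | (t : ℝ) ≤ u} = Iic (projIcc 0 1 zero_le_one u) := by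
  ext t
  rw [projIcc_of_mem zero_le_one hu]
  exact Iff.rfl

theorem monotone_cdf (μ : Measure I) [IsFiniteMeasure μ] :
    Monotone fun u : ℝ => μ.real {t : I | (t : ℝ) ≤ u} :=
  fun _ _ h => measureReal_mono fun _ ht => le_trans ht h

/-- Integration by parts: both sides are the integral of `g u` over the pairs `(t, u)` with
`t ≤ u`. -/
theorem integral_primitive_eq_integral_cdf (μ : Measure I) [IsFiniteMeasure μ] {g : ℝ → ℝ}
    (hg : IntegrableOn g (Icc 0 1)) :
    ∫ t : I, (∫ u in (t : ℝ)..1, g u) ∂μ =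
      ∫ u in (0 : ℝ)..1, g u * μ.real {t : I | (t : ℝ) ≤ u} := by
  have hS : MeasurableSet {p : I × ℝ | (p.1 : ℝ) ≤ p.2} :=
    measurableSet_le (by fun_prop) (by fun_prop)
  have key : ∀ t : I, (∫ u in (t : ℝ)..1, g u) =
      ∫ u in Icc (0 : ℝ) 1, {p : I × ℝ | (p.1 : ℝ) ≤ p.2}.indicator (fun p => g p.2) (t, u) := by
    intro t
    have h1 : ∀ u, {p : I × ℝ | (p.1 : ℝ) ≤ p.2}.indicator (fun p => g p.2) (t, u) =
        (Ici (t : ℝ)).indicator g u := fun u => by simp [indicator_apply]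
    have h2 : Ici (t : ℝ) ∩ Icc 0 1 = Icc (t : ℝ) 1 :=
      Set.ext fun u => ⟨fun h => ⟨h.1, h.2.2⟩, fun h => ⟨h.1, t.2.1.trans h.1, h.2⟩⟩
    simp_rw [h1]
    rw [intervalIntegral.integral_of_le t.2.2, ← integral_Icc_eq_integral_Ioc,
      integral_indicator measurableSet_Ici, Measure.restrict_restrict measurableSet_Ici, h2]
  have hint : Integrable (Function.uncurry fun (t : I) (u : ℝ) =>
      {p : I × ℝ | (p.1 : ℝ) ≤ p.2}.indicator (fun p => g p.2) (t, u))
      (μ.prod (volume.restrict (Icc (0 : ℝ) 1))) :=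
    (Integrable.comp_snd hg μ).indicator hS
  simp_rw [key]
  rw [integral_integral_swap hint, intervalIntegral.integral_of_le zero_le_one,
    ← integral_Icc_eq_integral_Ioc]
  refine integral_congr_ae (Eventually.of_forall fun u => ?_)
  have h1 : ∀ t : I, {p : I × ℝ | (p.1 : ℝ) ≤ p.2}.indicator (fun p => g p.2) (t, u) =
      {t : I | (t : ℝ) ≤ u}.indicator (fun _ => g u) t := fun t => by simp [indicator_apply]
  simp_rw [h1]
  rw [integral_indicator_const _ (measurableSet_le (by fun_prop) (by fun_prop)),
    smul_eq_mul, mul_comm]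

/-- Weak convergence from convergence of the distribution functions. Integrating by parts, it is
clear for polynomials, which are uniformly dense. -/
theorem tendsto_integral_of_tendsto_cdf {μ : ℕ → Measure I} {ν : Measure I}
    [∀ n, IsFiniteMeasure (μ n)] [IsFiniteMeasure ν] (hmass : ∀ n, (μ n).real univ = ν.real univ)
    {F : Set I} (hF : F.Finite)
    (h : ∀ t ∉ F, Tendsto (fun n => (μ n).real (Iic t)) atTop (𝓝 (ν.real (Iic t))))
    (f : C(I, ℝ)) : Tendsto (fun n => ∫ t, f t ∂(μ n)) atTop (𝓝 (∫ t, f t ∂ν)) := by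
  have hpoly : ∀ p : Polynomial ℝ, Tendsto (fun n => ∫ t : I, p.eval (t : ℝ) ∂(μ n)) atTop
      (𝓝 (∫ t : I, p.eval (t : ℝ) ∂ν)) := by
    intro p
    have hc : Continuous fun u : ℝ => p.derivative.eval u := p.derivative.continuous
    -- `p t = p 1 - ∫ u in t..1, p' u`, integrated by parts.
    have hparts : ∀ (m : Measure I) [IsFiniteMeasure m], ∫ t : I, p.eval (t : ℝ) ∂m =
        m.real univ * p.eval 1 -
          ∫ u in (0 : ℝ)..1, p.derivative.eval u * m.real {t : I | (t : ℝ) ≤ u} := by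
      intro m _
      have h1 : ∀ t : I, p.eval (t : ℝ) =
          p.eval 1 - ∫ u in (t : ℝ)..1, p.derivative.eval u := by
        intro t
        rw [intervalIntegral.integral_eq_sub_of_hasDerivAt (fun x _ => p.hasDerivAt x)
          (hc.intervalIntegrable _ _)]
        ring
      have h2 : Continuous fun t : I => ∫ u in (t : ℝ)..1, p.derivative.eval u := by
        have : ∀ t : I, (∫ u in (t : ℝ)..1, p.derivative.eval u) = p.eval 1 - p.eval (t : ℝ) :=
          fun t => by rw [h1 t]; ring
        simp_rw [this]
        fun_prop
      simp_rw [h1]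
      rw [integral_sub (integrable_const _)
        (h2.integrable_of_hasCompactSupport (HasCompactSupport.of_compactSpace _)),
        integral_primitive_eq_integral_cdf m
        hc.integrableOn_Icc, integral_const,
        smul_eq_mul]
    simp_rw [hparts, hmass]
    refine tendsto_const_nhds.sub ?_
    refine intervalIntegral.tendsto_integral_filter_of_dominated_convergence
      (fun u => |p.derivative.eval u| * ν.real univ) ?_ ?_ ?_ ?_
    · exact Eventually.of_forall fun n =>
        (hc.measurable.mul (monotone_cdf (μ n)).measurable).aestronglyMeasurable
    · refine Eventually.of_forall fun n => Eventually.of_forall fun u _ => ?_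
      rw [norm_mul, Real.norm_eq_abs, Real.norm_eq_abs, abs_of_nonneg measureReal_nonneg, ← hmass n]
      exact mul_le_mul_of_nonneg_left (measureReal_mono (subset_univ _)) (abs_nonneg _)
    · exact (hc.abs.mul continuous_const).intervalIntegrable _ _
    · have hnull : ∀ᵐ u : ℝ, u ∉ Subtype.val '' F :=
        (hF.image _).countable.ae_notMem volume
      filter_upwards [hnull] with u hu hu1
      rw [uIoc_of_le zero_le_one] at hu1
      have hu2 : u ∈ Icc (0 : ℝ) 1 := Ioc_subset_Icc_self hu1
      refine tendsto_const_nhds.mul ?_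
      simp_rw [setOf_coe_le_eq_Iic hu2]
      refine h _ fun hmem => hu ⟨_, hmem, ?_⟩
      rw [projIcc_of_mem zero_le_one hu2]
  rw [Metric.tendsto_atTop]
  intro ε hε
  set M := ν.real univ
  have hM : 0 ≤ M := measureReal_nonneg
  obtain ⟨p, hp⟩ := exists_polynomial_near_continuousMap 0 1 f (ε / (4 * (M + 1))) (by positivity)
  have hb : ∀ (m : Measure I) [IsFiniteMeasure m], m.real univ = M →
      |(∫ t, f t ∂m) - ∫ t : I, p.eval (t : ℝ) ∂m| ≤ ε / 4 := by
    intro m _ hm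
    have hpc : Continuous fun t : I => p.eval (t : ℝ) := by fun_prop
    rw [← integral_sub
      (f.continuous.integrable_of_hasCompactSupport (HasCompactSupport.of_compactSpace _))
      (hpc.integrable_of_hasCompactSupport (HasCompactSupport.of_compactSpace _)),
      ← Real.norm_eq_abs]
    refine (norm_integral_le_of_norm_le_const (C := ε / (4 * (M + 1)))
      (Eventually.of_forall fun t => ?_)).trans ?_
    · rw [norm_sub_rev]
      exact ((p.toContinuousMapOn (Icc 0 1) - f).norm_coe_le_norm t).trans hp.le
    · rw [hm, div_mul_eq_mul_div, div_le_div_iff₀ (by positivity) (by positivity)]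
      nlinarith
  obtain ⟨N, hN⟩ := Metric.tendsto_atTop.1 (hpoly p) (ε / 4) (by positivity)
  refine ⟨N, fun n hn => ?_⟩
  have h1 := hb (μ n) (hmass n)
  have h2 := hb ν rfl
  have h3 := hN n hn
  rw [Real.dist_eq] at h3 ⊢
  rw [abs_le] at h1 h2
  rw [abs_lt] at h3 ⊢
  constructor <;> linarith [h1.1, h1.2, h2.1, h2.2, h3.1, h3.2]

/-- A nonnegative monotone right-continuous function on `[0,1]` is the distribution function of a
finite measure. -/
theorem exists_measure_real_Iic_eq {h : I → ℝ} (hm : Monotone h)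
    (hr : ∀ t, ContinuousWithinAt h (Ici t) t) (h0 : ∀ t, 0 ≤ h t) :
    ∃ μ : Measure I, IsFiniteMeasure μ ∧ ∀ t, μ.real (Iic t) = h t := by
  let s : StieltjesFunction I := ⟨h, hm, hr⟩
  have hb : IsBot (0 : I) := fun _ => unitInterval.nonneg'
  have hfin : IsFiniteMeasure s.measure := by
    refine s.isFiniteMeasure_of_forall_abs_le (C := h 1) fun t => ?_
    rw [abs_of_nonneg (h0 t)]
    exact hm unitInterval.le_one'
  -- The Stieltjes measure does not charge `0`, so the mass `h 0` is added there.
  refine ⟨ENNReal.ofReal (h 0) • Measure.dirac 0 + s.measure, ?_, fun t => ?_⟩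
  · have := (Measure.dirac (0 : I)).smul_finite (c := ENNReal.ofReal (h 0)) ENNReal.ofReal_ne_top
    infer_instance
  · have hI : Iic t = Icc 0 t := Set.ext fun s => ⟨fun h => ⟨hb s, h⟩, fun h => h.2⟩
    have hl : Function.leftLim s 0 = h 0 := leftLim_eq_of_isBot hb
    have h1 : (ENNReal.ofReal (h 0) • Measure.dirac (0 : I) + s.measure) (Iic t) =
        ENNReal.ofReal (h t) := by
      rw [Measure.add_apply, Measure.smul_apply,
        Measure.dirac_apply_of_mem (show (0 : I) ∈ Iic t from hb t), hI,
        s.measure_Icc, hl, smul_eq_mul, mul_one, ← ENNReal.ofReal_add (h0 0)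
        (sub_nonneg.2 (hm (hb t)))]
      congr 1
      change h 0 + (h t - h 0) = h t
      ring
    rw [measureReal_def, h1, ENNReal.toReal_ofReal (h0 t)]

/-! ### Integrals with respect to `dv` -/

theorem FiniteVariation.integral_eq_sub {v : FiniteVariation} {μ ν : Measure I}
    [IsFiniteMeasure μ] [IsFiniteMeasure ν]
    (h : v.measure = μ.toSignedMeasure - ν.toSignedMeasure) (f : C(I, ℝ)) :
    v.integral f = ∫ t, f t ∂μ - ∫ t, f t ∂ν := by
  have hflip : (ContinuousLinearMap.lsmul ℝ ℝ : ℝ →L[ℝ] ℝ →L[ℝ] ℝ) =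
      (ContinuousLinearMap.lsmul ℝ ℝ : ℝ →L[ℝ] ℝ →L[ℝ] ℝ).flip := by
    ext; simp
  have hi : ∀ (m : Measure I) [IsFiniteMeasure m], m.toSignedMeasure.Integrable f := by
    intro m _
    rw [VectorMeasure.Integrable, Measure.variation_toSignedMeasure]
    exact f.continuous.integrable_of_hasCompactSupport (HasCompactSupport.of_compactSpace _)
  rw [FiniteVariation.integral, h, VectorMeasure.integral_sub_vectorMeasure (hi μ) (hi ν), hflip,
    VectorMeasure.integral_toSignedMeasure, VectorMeasure.integral_toSignedMeasure]

/-- Signed measures on `[0,1]` are determined by their values on the initial intervals. -/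
theorem FiniteVariation.measure_eq_sub {v : FiniteVariation} {μ ν : Measure I}
    [IsFiniteMeasure μ] [IsFiniteMeasure ν]
    (h : ∀ t, v.toFun t = μ.real (Iic t) - ν.real (Iic t)) :
    v.measure = μ.toSignedMeasure - ν.toSignedMeasure := by
  have hI : ∀ t : I, v.measure (Iic t) = (μ.toSignedMeasure - ν.toSignedMeasure) (Iic t) := by
    intro t
    rw [v.measure_Iic, h, Measure.toSignedMeasure_sub_apply measurableSet_Iic]
  refine VectorMeasure.ext_of_generateFrom (range Iic) ?_ ?_ isPiSystem_Iic ?_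
  · rintro _ ⟨t, rfl⟩
    exact hI t
  · rw [BorelSpace.measurable_eq (α := I)]
    exact borel_eq_generateFrom_Iic I
  · have : (univ : Set I) = Iic 1 := (Iic_top (α := I)).symm
    rw [this]
    exact hI 1

/-- The Jordan decomposition of `dv`. -/
theorem FiniteVariation.exists_measure_eq_sub (v : FiniteVariation) :
    ∃ (μ ν : Measure I) (_ : IsFiniteMeasure μ) (_ : IsFiniteMeasure ν),
      (∀ t, v.toFun t = μ.real (Iic t) - ν.real (Iic t)) ∧
      v.measure = μ.toSignedMeasure - ν.toSignedMeasure := by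
  have h : v.measure = v.measure.toJordanDecomposition.posPart.toSignedMeasure -
      v.measure.toJordanDecomposition.negPart.toSignedMeasure :=
    v.measure.toSignedMeasure_toJordanDecomposition.symm
  refine ⟨_, _, inferInstance, inferInstance, fun t => ?_, h⟩
  rw [← v.measure_Iic, ← Measure.toSignedMeasure_sub_apply measurableSet_Iic, ← h]

theorem FiniteVariation.integral_one (v : FiniteVariation) :
    v.integral (ContinuousMap.const I 1) = v.toFun 1 := by
  obtain ⟨μ, ν, _, _, h1, h2⟩ := v.exists_measure_eq_sub
  have : (Iic 1 : Set I) = univ := Iic_top (α := I)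
  rw [FiniteVariation.integral_eq_sub h2, h1, this]
  simp

theorem FiniteVariation.intervalIntegrable (v : FiniteVariation) {a b : ℝ} :
    IntervalIntegrable (fun u => v.toFun (projIcc 0 1 zero_le_one u)) volume a b := by
  obtain ⟨μ, ν, _, _, h1, h2⟩ := v.exists_measure_eq_sub
  have hm : ∀ (m : Measure I) [IsFiniteMeasure m], Monotone fun u : ℝ =>
      m.real (Iic (projIcc 0 1 zero_le_one u)) :=
    fun m _ _ _ h => measureReal_mono (Iic_subset_Iic.2 (monotone_projIcc zero_le_one h))
  simp_rw [h1]
  exact (hm μ).intervalIntegrable.sub (hm ν).intervalIntegrable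

/-- The continuous function `t ↦ |[t,1] ∩ [a,b]|`, against which `dv` integrates to
`∫ u in a..b, v u`. -/
noncomputable def ramp (a b : ℝ) : C(I, ℝ) where
  toFun t := ∫ u in (t : ℝ)..1, (Ioc a b).indicator (fun _ => (1 : ℝ)) u
  continuous_toFun := by
    have hi : ∀ c d : ℝ,
        IntervalIntegrable ((Ioc a b).indicator fun _ => (1 : ℝ)) volume c d := by
      intro c d
      refine Integrable.intervalIntegrable ?_
      rw [integrable_indicator_iff measurableSet_Ioc]
      exact integrableOn_const measure_Ioc_lt_top.ne
    simp_rw [intervalIntegral.integral_symm 1]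
    exact ((intervalIntegral.continuous_primitive hi 1).comp continuous_subtype_val).neg

theorem FiniteVariation.integral_ramp (v : FiniteVariation) {a b : ℝ} (ha : 0 ≤ a) (hab : a ≤ b)
    (hb : b ≤ 1) : v.integral (ramp a b) =
      ∫ u in a..b, v.toFun (projIcc 0 1 zero_le_one u) := by
  obtain ⟨μ, ν, _, _, h1, h2⟩ := v.exists_measure_eq_sub
  have hm : ∀ (m : Measure I) [IsFiniteMeasure m], IntervalIntegrable (fun u : ℝ =>
      m.real (Iic (projIcc 0 1 zero_le_one u))) volume a b := fun m _ =>
    Monotone.intervalIntegrable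
      (fun _ _ h => measureReal_mono (Iic_subset_Iic.2 (monotone_projIcc zero_le_one h)))
  have key : ∀ (m : Measure I) [IsFiniteMeasure m], ∫ t, ramp a b t ∂m =
      ∫ u in a..b, m.real (Iic (projIcc 0 1 zero_le_one u)) := by
    intro m _
    have hint : IntegrableOn ((Ioc a b).indicator fun _ => (1 : ℝ)) (Icc (0 : ℝ) 1) :=
      (integrable_const _).indicator measurableSet_Ioc
    refine (integral_primitive_eq_integral_cdf m hint).trans ?_
    have h3 : ∀ u : ℝ, (Ioc a b).indicator (fun _ => (1 : ℝ)) u * m.real {t : I | (t : ℝ) ≤ u} =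
        (Ioc a b).indicator (fun u => m.real {t : I | (t : ℝ) ≤ u}) u := by
      intro u
      by_cases hu : u ∈ Ioc a b <;> simp [hu]
    simp_rw [h3]
    rw [intervalIntegral.integral_of_le zero_le_one, intervalIntegral.integral_of_le hab,
      integral_indicator measurableSet_Ioc, Measure.restrict_restrict measurableSet_Ioc,
      inter_eq_self_of_subset_left (Ioc_subset_Ioc ha hb)]
    refine setIntegral_congr_fun measurableSet_Ioc fun u hu => ?_
    rw [setOf_coe_le_eq_Iic ⟨ha.trans hu.1.le, hu.2.trans hb⟩]
  rw [FiniteVariation.integral_eq_sub h2, key μ, key ν,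
    ← intervalIntegral.integral_sub (hm μ) (hm ν)]
  simp_rw [h1]

/-! ### Completed graphs -/

theorem tendsto_leftLim (x : SkorokhodSpace) (t : I) :
    Tendsto x (𝓝[<] t) (𝓝 (Function.leftLim x t)) := by
  rcases eq_or_neBot (𝓝[<] t) with h | h
  · rw [h]; exact tendsto_bot
  · obtain ⟨l, hl⟩ := x.exists_leftLim t
    rwa [leftLim_eq_of_tendsto hl]

theorem mk_mem_completedGraph (x : SkorokhodSpace) (t : I) : (x t, t) ∈ completedGraph x :=
  right_mem_uIcc

theorem abs_sub_leftLim_le {x : SkorokhodSpace} {z : ℝ} {t : I} (h : (z, t) ∈ completedGraph x) :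
    |z - Function.leftLim x t| ≤ |x t - Function.leftLim x t| := abs_sub_left_of_mem_uIcc h

/-- Within the completed graph, `(x t, t)` is the largest point at time `t`. -/
theorem eq_mk_of_graphLE {x : SkorokhodSpace} {t : I} {p : ℝ × I} (hp : p ∈ completedGraph x)
    (hle : graphLE x (x t, t) p) (ht : p.2 ≤ t) : p = (x t, t) := by
  obtain ⟨z, s⟩ := p
  rcases hle with h | ⟨h, h'⟩
  · exact absurd ht (not_le.2 h)
  · simp only at h h'
    subst h
    have : z = x t := by
      have hz : z ∈ uIcc (Function.leftLim x t) (x t) := hp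
      rcases le_total (Function.leftLim x t) (x t) with hc | hc
      · rw [uIcc_of_le hc] at hz
        rw [abs_of_nonneg (sub_nonneg.2 hc), abs_of_nonneg (sub_nonneg.2 hz.1)] at h'
        linarith [hz.2]
      · rw [uIcc_of_ge hc] at hz
        rw [abs_of_nonpos (sub_nonpos.2 hc), abs_of_nonpos (sub_nonpos.2 hz.2)] at h'
        linarith [hz.1]
    rw [this]

theorem abs_sub_le_of_mem_completedGraph {x : SkorokhodSpace} {a b : I} {c η : ℝ}
    (h : ∀ u ∈ Ioo a b, |x u - c| ≤ η) {p : ℝ × I} (hp : p ∈ completedGraph x)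
    (hu : p.2 ∈ Ioo a b) : |p.1 - c| ≤ η := by
  have hx := h _ hu
  have : (𝓝[<] p.2).NeBot := nhdsLT_neBot_of_exists_lt ⟨a, hu.1⟩
  have hl : |Function.leftLim x p.2 - c| ≤ η := by
    refine le_of_tendsto ((x.tendsto_leftLim p.2).sub_const c).abs ?_
    filter_upwards [Ioo_mem_nhdsLT hu.1] with s hs using h s ⟨hs.1, hs.2.trans hu.2⟩
  rw [abs_le] at hx hl ⊢
  have := uIcc_subset_Icc (a₂ := c - η) (b₂ := c + η) ⟨by linarith [hl.1], by linarith [hl.2]⟩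
    ⟨by linarith [hx.1], by linarith [hx.2]⟩ hp
  constructor <;> linarith [this.1, this.2]

/-- Just after time `t`, the completed graph stays close to `x t`. -/
theorem exists_forall_Ioo_abs_sub_right_le (x : SkorokhodSpace) {t : I} (ht : t < 1) {η : ℝ}
    (hη : 0 < η) :
    ∃ b > t, ∀ p ∈ completedGraph x, p.2 ∈ Ioo t b → |p.1 - x t| ≤ η := by
  have h1 : ∀ᶠ u in 𝓝[>] t, |x u - x t| ≤ η := by
    have := (x.rightContinuous t).mono (Ioi_subset_Ici_self)
    filter_upwards [this (Metric.closedBall_mem_nhds (x t) hη)] with u hu using hu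
  obtain ⟨b, hb, hsub⟩ := (mem_nhdsGT_iff_exists_Ioo_subset' ht).1 h1
  exact ⟨b, hb, fun p hp hu => abs_sub_le_of_mem_completedGraph (fun u hu => hsub hu) hp hu⟩

/-- Just before time `t`, the completed graph stays close to `x (t-)`. -/
theorem exists_forall_Ioo_abs_sub_left_le (x : SkorokhodSpace) {t : I} (ht : 0 < t) {η : ℝ}
    (hη : 0 < η) :
    ∃ a < t, ∀ p ∈ completedGraph x, p.2 ∈ Ioo a t → |p.1 - Function.leftLim x t| ≤ η := by
  have h1 : ∀ᶠ u in 𝓝[<] t, |x u - Function.leftLim x t| ≤ η := by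
    filter_upwards [x.tendsto_leftLim t (Metric.closedBall_mem_nhds _ hη)] with u hu using hu
  obtain ⟨a, ha, hsub⟩ := (mem_nhdsLT_iff_exists_Ioo_subset' ht).1 h1
  exact ⟨a, ha, fun p hp hu => abs_sub_le_of_mem_completedGraph (fun u hu => hsub hu) hp hu⟩

/-- A right-continuous nondecreasing path in the completed graph of `x` which ends at its last
point; it need not run through the whole graph. -/
structure GraphPath (x : SkorokhodSpace) where
  toFun : I → ℝ × I
  mem : ∀ t, toFun t ∈ completedGraph x
  mono : ∀ s s', s ≤ s' → graphLE x (toFun s) (toFun s')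
  rightContinuous : ∀ t, ContinuousWithinAt toFun (Ici t) t
  map_one : toFun 1 = (x 1, 1)

theorem GraphPath.time_mono {x : SkorokhodSpace} (P : GraphPath x) {s s' : I} (h : s ≤ s') :
    (P.toFun s).2 ≤ (P.toFun s').2 := by
  rcases P.mono s s' h with h | h
  · exact h.le
  · exact h.1.le

/-! ### Monotone functions on a completed graph -/

/-- A nonnegative function on `ℝ × [0,1]` which is nondecreasing along the completed graph of `x`,
right-continuous along every path in it, and, away from finitely many times, locally constant and
a function of the time only. -/
structure IsGraphMonotone (x : SkorokhodSpace) (H : ℝ × I → ℝ) : Prop where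
  nonneg : ∀ p, 0 ≤ H p
  mono : ∀ p ∈ completedGraph x, ∀ q ∈ completedGraph x, graphLE x p q → H p ≤ H q
  rightContinuous : ∀ (P : GraphPath x) (s : I),
    ContinuousWithinAt (fun s => H (P.toFun s)) (Ici s) s
  locallyConst : ∃ F : Set I, F.Finite ∧ ∀ t ∉ F, ∀ᶠ u in 𝓝 t, ∀ z z' : ℝ, H (z', u) = H (z, t)

namespace IsGraphMonotone

variable {x : SkorokhodSpace} {H H' : ℝ × I → ℝ}

theorem const {c : ℝ} (hc : 0 ≤ c) : IsGraphMonotone x fun _ => c where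
  nonneg _ := hc
  mono _ _ _ _ _ := le_rfl
  rightContinuous _ _ := continuousWithinAt_const
  locallyConst := ⟨∅, finite_empty, fun _ _ => Eventually.of_forall fun _ _ _ => rfl⟩

theorem add (h : IsGraphMonotone x H) (h' : IsGraphMonotone x H') :
    IsGraphMonotone x fun p => H p + H' p where
  nonneg p := add_nonneg (h.nonneg p) (h'.nonneg p)
  mono p hp q hq hpq := add_le_add (h.mono p hp q hq hpq) (h'.mono p hp q hq hpq)
  rightContinuous P s := (h.rightContinuous P s).add (h'.rightContinuous P s)
  locallyConst := by
    obtain ⟨F, hF, hc⟩ := h.locallyConst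
    obtain ⟨F', hF', hc'⟩ := h'.locallyConst
    refine ⟨F ∪ F', hF.union hF', fun t ht => ?_⟩
    rw [mem_union, not_or] at ht
    filter_upwards [hc t ht.1, hc' t ht.2] with u hu hu' z z'
    rw [hu z z', hu' z z']

theorem const_mul (h : IsGraphMonotone x H) {c : ℝ} (hc : 0 ≤ c) :
    IsGraphMonotone x fun p => c * H p where
  nonneg p := mul_nonneg hc (h.nonneg p)
  mono p hp q hq hpq := mul_le_mul_of_nonneg_left (h.mono p hp q hq hpq) hc
  rightContinuous P s := (h.rightContinuous P s).const_mul c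
  locallyConst := by
    obtain ⟨F, hF, hF'⟩ := h.locallyConst
    refine ⟨F, hF, fun t ht => (hF' t ht).mono fun u hu z z' => ?_⟩
    rw [hu z z']

end IsGraphMonotone

/-- The indicator function of the times from `T` on. -/
noncomputable def stepAt (T : I) (p : ℝ × I) : ℝ := if p.2 < T then 0 else 1

/-- The part of the jump of `x` at time `T` which lies before the point `p` of the completed
graph. -/
noncomputable def jumpAt (x : SkorokhodSpace) (T : I) (p : ℝ × I) : ℝ :=
  if p.2 < T then 0 else if p.2 = T then |p.1 - Function.leftLim x T|
  else |x T - Function.leftLim x T|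

theorem stepAt_of_lt {T : I} {p : ℝ × I} (h : p.2 < T) : stepAt T p = 0 := if_pos h

theorem stepAt_of_le {T : I} {p : ℝ × I} (h : T ≤ p.2) : stepAt T p = 1 := if_neg (not_lt.2 h)

theorem jumpAt_of_lt {x : SkorokhodSpace} {T : I} {p : ℝ × I} (h : p.2 < T) :
    jumpAt x T p = 0 := if_pos h

theorem jumpAt_of_eq {x : SkorokhodSpace} {T : I} {p : ℝ × I} (h : p.2 = T) :
    jumpAt x T p = |p.1 - Function.leftLim x T| := by
  rw [jumpAt, if_neg h.not_lt, if_pos h]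

theorem jumpAt_of_gt {x : SkorokhodSpace} {T : I} {p : ℝ × I} (h : T < p.2) :
    jumpAt x T p = |x T - Function.leftLim x T| := by
  rw [jumpAt, if_neg h.not_gt, if_neg h.ne']

theorem jumpAt_nonneg (x : SkorokhodSpace) (T : I) (p : ℝ × I) : 0 ≤ jumpAt x T p := by
  unfold jumpAt
  split_ifs <;> positivity

theorem isGraphMonotone_stepAt (x : SkorokhodSpace) (T : I) : IsGraphMonotone x (stepAt T) where
  nonneg p := by unfold stepAt; split_ifs <;> norm_num
  mono p _ q _ hpq := by
    have hle : p.2 ≤ q.2 := hpq.elim le_of_lt fun h => h.1.le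
    rcases lt_or_ge p.2 T with h | h
    · rw [stepAt_of_lt h]
      unfold stepAt; split_ifs <;> norm_num
    · rw [stepAt_of_le h, stepAt_of_le (h.trans hle)]
  rightContinuous P s := by
    rcases lt_or_ge (P.toFun s).2 T with h | h
    · have h1 : ∀ᶠ u in 𝓝[≥] s, (P.toFun u).2 < T :=
        (P.rightContinuous s).snd.eventually_lt_const h
      refine (continuousWithinAt_const (b := (0 : ℝ))).congr_of_eventuallyEq
        (h1.mono fun u hu => stepAt_of_lt hu) (stepAt_of_lt h)
    · exact (continuousWithinAt_const (b := (1 : ℝ))).congr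
        (fun u hu => stepAt_of_le (h.trans (P.time_mono hu))) (stepAt_of_le h)
  locallyConst := by
    refine ⟨{T}, finite_singleton T, fun t ht => ?_⟩
    rcases lt_or_gt_of_ne (show t ≠ T from ht) with h | h
    · filter_upwards [eventually_lt_nhds h] with u hu z z'
      rw [stepAt_of_lt hu, stepAt_of_lt h]
    · filter_upwards [eventually_gt_nhds h] with u hu z z'
      rw [stepAt_of_le (le_of_lt hu), stepAt_of_le (le_of_lt h)]

theorem isGraphMonotone_jumpAt (x : SkorokhodSpace) (T : I) : IsGraphMonotone x (jumpAt x T) where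
  nonneg := jumpAt_nonneg x T
  mono p hp q hq hpq := by
    have hle : p.2 ≤ q.2 := hpq.elim le_of_lt fun h => h.1.le
    rcases lt_trichotomy p.2 T with h | h | h
    · rw [jumpAt_of_lt h]
      exact jumpAt_nonneg x T q
    · rcases hle.eq_or_lt with h' | h'
      · rw [jumpAt_of_eq h, jumpAt_of_eq (h'.symm.trans h), ← h]
        exact hpq.elim (fun hlt => absurd h' hlt.ne) fun h => h.2
      · rw [jumpAt_of_eq h, jumpAt_of_gt (h ▸ h'), ← h]
        exact abs_sub_leftLim_le hp
    · rw [jumpAt_of_gt h, jumpAt_of_gt (h.trans_le hle)]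
  rightContinuous P s := by
    have hc := P.rightContinuous s
    rcases lt_trichotomy (P.toFun s).2 T with h | h | h
    · have h1 : ∀ᶠ u in 𝓝[≥] s, (P.toFun u).2 < T := hc.snd.eventually_lt_const h
      exact (continuousWithinAt_const (b := (0 : ℝ))).congr_of_eventuallyEq
        (h1.mono fun u hu => jumpAt_of_lt hu) (jumpAt_of_lt h)
    · have hcont : ContinuousWithinAt (fun u => |(P.toFun u).1 - Function.leftLim x T|)
          (Ici s) s := (hc.fst.sub continuousWithinAt_const).abs
      by_cases hex : ∃ s₁ > s, (P.toFun s₁).2 = T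
      · obtain ⟨s₁, hs₁, hT⟩ := hex
        refine hcont.congr_of_eventuallyEq ?_ (jumpAt_of_eq h)
        filter_upwards [Ico_mem_nhdsGE hs₁] with u hu
        exact jumpAt_of_eq (le_antisymm (hT ▸ P.time_mono hu.2.le) (h ▸ P.time_mono hu.1))
      · have hgt : ∀ u > s, T < (P.toFun u).2 := fun u hu =>
          lt_of_le_of_ne (h ▸ P.time_mono (le_of_lt hu)) fun he => hex ⟨u, hu, he.symm⟩
        -- The path leaves time `T` at once, so by right-continuity of `x` it is at `x T`.
        rcases eq_or_ne s 1 with rfl | hs1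
        · have : Ici (1 : I) = {1} := Ici_top
          rw [this]
          exact continuousWithinAt_singleton
        have hs1' : s < 1 := lt_of_le_of_ne unitInterval.le_one' hs1
        have hT1 : T < 1 := (hgt 1 hs1').trans_le unitInterval.le_one'
        have hw : (P.toFun s).1 = x T := by
          have : (𝓝[>] s).NeBot := nhdsGT_neBot_of_exists_gt ⟨1, hs1'⟩
          refine eq_of_abs_sub_le_all fun η hη => ?_
          obtain ⟨b, hb, hnear⟩ := x.exists_forall_Ioo_abs_sub_right_le hT1 hη
          have hc' := hc.mono (Ioi_subset_Ici_self)
          refine le_of_tendsto (hc'.fst.sub_const (x T)).abs ?_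
          filter_upwards [hc'.snd.eventually_lt_const (h.trans_lt hb), self_mem_nhdsWithin]
            with u hu hu'
          exact hnear _ (P.mem u) ⟨hgt u hu', hu⟩
        refine (continuousWithinAt_const (b := |x T - Function.leftLim x T|)).congr ?_ ?_
        · intro u hu
          rcases eq_or_lt_of_le (show s ≤ u from hu) with rfl | hu
          · rw [jumpAt_of_eq h, hw]
          · exact jumpAt_of_gt (hgt u hu)
        · rw [jumpAt_of_eq h, hw]
    · exact (continuousWithinAt_const (b := |x T - Function.leftLim x T|)).congr
        (fun u hu => jumpAt_of_gt (h.trans_le (P.time_mono hu))) (jumpAt_of_gt h)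
  locallyConst := by
    refine ⟨{T}, finite_singleton T, fun t ht => ?_⟩
    rcases lt_or_gt_of_ne (show t ≠ T from ht) with h | h
    · filter_upwards [eventually_lt_nhds h] with u hu z z'
      rw [jumpAt_of_lt hu, jumpAt_of_lt h]
    · filter_upwards [eventually_gt_nhds h] with u hu z z'
      rw [jumpAt_of_gt hu, jumpAt_of_gt h]

/-- Differences of two graph-monotone functions. -/
def IsGraphBV (x : SkorokhodSpace) (G : ℝ × I → ℝ) : Prop :=
  ∃ H H', IsGraphMonotone x H ∧ IsGraphMonotone x H' ∧ ∀ p, G p = H p - H' p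

theorem IsGraphBV.add {x : SkorokhodSpace} {G G' : ℝ × I → ℝ} (h : IsGraphBV x G)
    (h' : IsGraphBV x G') : IsGraphBV x fun p => G p + G' p := by
  obtain ⟨A, B, hA, hB, hG⟩ := h
  obtain ⟨A', B', hA', hB', hG'⟩ := h'
  exact ⟨_, _, hA.add hA', hB.add hB', fun p => by simp only [hG, hG']; ring⟩

theorem IsGraphMonotone.isGraphBV_const_mul {x : SkorokhodSpace} {H : ℝ × I → ℝ}
    (h : IsGraphMonotone x H) (c : ℝ) : IsGraphBV x fun p => c * H p := by
  rcases le_total 0 c with hc | hc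
  · exact ⟨_, _, h.const_mul hc, IsGraphMonotone.const le_rfl, fun p => by ring⟩
  · exact ⟨_, _, IsGraphMonotone.const le_rfl, h.const_mul (neg_nonneg.2 hc), fun p => by ring⟩

/-- Along the completed graph at a fixed time, the displacement from the left limit has the sign of
the jump. -/
theorem sign_mul_abs_sub_leftLim {x : SkorokhodSpace} {p : ℝ × I} (hp : p ∈ completedGraph x) :
    SignType.sign (x p.2 - Function.leftLim x p.2) * |p.1 - Function.leftLim x p.2| =
      p.1 - Function.leftLim x p.2 := by
  have hz : p.1 ∈ uIcc (Function.leftLim x p.2) (x p.2) := hp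
  rcases lt_trichotomy (Function.leftLim x p.2) (x p.2) with h | h | h
  · rw [uIcc_of_le h.le] at hz
    rw [sign_pos (sub_pos.2 h), abs_of_nonneg (sub_nonneg.2 hz.1)]
    simp
  · rw [← h, uIcc_self] at hz
    rw [mem_singleton_iff.1 hz]
    simp
  · rw [uIcc_of_ge h.le] at hz
    rw [sign_neg (sub_neg.2 h), abs_of_nonpos (sub_nonpos.2 hz.2)]
    simp

/-- One step of the construction in `exists_isGraphBV_approx`: an approximation up to time `T` is
continued through the following interval `(T, T')`, where it is constant, and the jump at `T'`,
where it follows the completed graph. -/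
theorem exists_isGraphBV_extend {x : SkorokhodSpace} {ε : ℝ} {T T' : I} (hT : T < T')
    (hosc : ∀ p ∈ completedGraph x, p.2 ∈ Ioo T T' → |p.1 - x T| ≤ ε) (hε : 0 ≤ ε)
    (h : ∃ G, IsGraphBV x G ∧ (∀ p ∈ completedGraph x, p.2 ≤ T → |G p - p.1| ≤ ε) ∧
      ∀ p, T < p.2 → G p = x T) :
    ∃ G, IsGraphBV x G ∧ (∀ p ∈ completedGraph x, p.2 ≤ T' → |G p - p.1| ≤ ε) ∧
      ∀ p, T' < p.2 → G p = x T' := by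
  obtain ⟨G, hG, hclose, hconst⟩ := h
  refine ⟨_, (hG.add ((isGraphMonotone_stepAt x T').isGraphBV_const_mul
    (Function.leftLim x T' - x T))).add ((isGraphMonotone_jumpAt x T').isGraphBV_const_mul
    (SignType.sign (x T' - Function.leftLim x T'))), fun p hp hp' => ?_, fun p hp => ?_⟩
  · rcases hp'.lt_or_eq with h | h
    · rw [stepAt_of_lt h, jumpAt_of_lt h, mul_zero, mul_zero, add_zero, add_zero]
      rcases le_or_gt p.2 T with h' | h'
      · exact hclose p hp h'
      · rw [hconst p h', abs_sub_comm]
        exact hosc p hp ⟨h', h⟩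
    · subst h
      rw [stepAt_of_le le_rfl, jumpAt_of_eq rfl, hconst p hT, sign_mul_abs_sub_leftLim hp]
      ring_nf
      simpa using hε
  · rw [stepAt_of_le hp.le, jumpAt_of_gt hp, hconst p (hT.trans hp),
      sign_mul_abs_sub_leftLim (x.mk_mem_completedGraph T')]
    ring

/-- The first coordinate on the completed graph of `x` is uniformly close to differences of
graph-monotone functions. -/
theorem exists_isGraphBV_approx (x : SkorokhodSpace) {ε : ℝ} (hε : 0 < ε) :
    ∃ G, IsGraphBV x G ∧ ∀ p ∈ completedGraph x, |G p - p.1| ≤ ε := by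
  set S : Set I := {T | ∃ G, IsGraphBV x G ∧
    (∀ p ∈ completedGraph x, p.2 ≤ T → |G p - p.1| ≤ ε) ∧ ∀ p, T < p.2 → G p = x T} with hS
  have h0 : (0 : I) ∈ S := by
    refine ⟨_, (IsGraphMonotone.const zero_le_one).isGraphBV_const_mul (x 0), ?_,
      fun p _ => by ring⟩
    rintro ⟨z, t⟩ hp ht
    have ht0 : t = 0 := le_antisymm ht unitInterval.nonneg'
    subst ht0
    have hl : Function.leftLim x 0 = x 0 := leftLim_eq_of_isBot fun _ => unitInterval.nonneg'
    have hz : z ∈ uIcc (Function.leftLim x 0) (x 0) := hp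
    rw [hl, uIcc_self, mem_singleton_iff] at hz
    simpa [hz] using hε.le
  have hsup : sSup S ∈ S := by
    rcases eq_or_ne (sSup S) 0 with h | h
    · rwa [h]
    obtain ⟨a, ha, hnear⟩ := x.exists_forall_Ioo_abs_sub_left_le
      (lt_of_le_of_ne unitInterval.nonneg' h.symm) (half_pos hε)
    obtain ⟨T, hT, haT⟩ := exists_lt_of_lt_csSup ⟨0, h0⟩ ha
    rcases (le_sSup hT).eq_or_lt with h' | h'
    · rwa [← h']
    refine exists_isGraphBV_extend h' (fun p hp hu => ?_) hε.le hT
    have h1 := hnear p hp ⟨haT.trans hu.1, hu.2⟩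
    have h2 := hnear _ (x.mk_mem_completedGraph T) ⟨haT, h'⟩
    simp only at h2
    rw [abs_le] at *
    constructor <;> linarith [h1.1, h1.2, h2.1, h2.2]
  have hone : sSup S = 1 := by
    by_contra hne
    obtain ⟨b, hb, hnear⟩ := x.exists_forall_Ioo_abs_sub_right_le
      (lt_of_le_of_ne unitInterval.le_one' hne) hε
    have hbS : b ∈ S := exists_isGraphBV_extend hb hnear hε.le hsup
    exact absurd (le_sSup hbS) (not_le.2 hb)
  rw [hone] at hsup
  obtain ⟨G, hG, hclose, -⟩ := hsup
  exact ⟨G, hG, fun p hp => hclose p hp unitInterval.le_one'⟩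

/-! ### A criterion for `S`-convergence -/

theorem exists_finiteVariation_eq_sub {h h' : I → ℝ} (hm : Monotone h) (hm' : Monotone h')
    (hr : ∀ t, ContinuousWithinAt h (Ici t) t) (hr' : ∀ t, ContinuousWithinAt h' (Ici t) t) :
    ∃ v : FiniteVariation, ∀ t, v.toFun t = h t - h' t := by
  have hbv : BoundedVariationOn (fun t => h t - h' t) univ := by
    have hs : BoundedVariationOn (fun t => h t + h' t) univ := by
      refine ((hm.add hm').monotoneOn univ).boundedVariationOn
        (C := max |h 0 + h' 0| |h 1 + h' 1|) fun t _ => ?_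
      exact abs_le_max_abs_abs ((hm.add hm') unitInterval.nonneg')
        ((hm.add hm') unitInterval.le_one')
    refine ne_top_of_le_ne_top hs (iSup_mono fun p => Finset.sum_le_sum fun i _ => ?_)
    have h1 := hm (p.2.2.1 (Nat.le_succ i))
    have h2 := hm' (p.2.2.1 (Nat.le_succ i))
    rw [edist_dist, edist_dist, Real.dist_eq, Real.dist_eq]
    refine ENNReal.ofReal_le_ofReal (abs_le_abs ?_ ?_) <;> linarith
  exact ⟨{ toFun := fun t => h t - h' t
           rightContinuous := fun t => (hr t).sub (hr' t)
           exists_leftLim := fun t => ⟨_, (hm.tendsto_leftLim t).sub (hm'.tendsto_leftLim t)⟩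
           boundedVariation := hbv }, fun t => rfl⟩

/-- The path `t ↦ (x t, t)`. -/
def GraphPath.refl (x : SkorokhodSpace) : GraphPath x where
  toFun t := (x t, t)
  mem := x.mk_mem_completedGraph
  mono s s' h := by
    rcases h.lt_or_eq with h | rfl
    · exact Or.inl h
    · exact Or.inr ⟨rfl, le_rfl⟩
  rightContinuous t := (x.rightContinuous t).prodMk continuousWithinAt_id
  map_one := rfl

variable {x : SkorokhodSpace}

theorem IsGraphMonotone.monotone_comp {H : ℝ × I → ℝ} (hH : IsGraphMonotone x H)
    (P : GraphPath x) : Monotone fun t => H (P.toFun t) :=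
  fun _ _ h => hH.mono _ (P.mem _) _ (P.mem _) (P.mono _ _ h)

theorem IsGraphBV.exists_finiteVariation {G : ℝ × I → ℝ} (hG : IsGraphBV x G) (P : GraphPath x) :
    ∃ v : FiniteVariation, ∀ t, v.toFun t = G (P.toFun t) := by
  obtain ⟨H, H', hH, hH', hG⟩ := hG
  obtain ⟨v, hv⟩ := exists_finiteVariation_eq_sub (hH.monotone_comp P) (hH'.monotone_comp P)
    (hH.rightContinuous P) (hH'.rightContinuous P)
  exact ⟨v, fun t => by rw [hv, hG]⟩

theorem exists_finiteVariation_approx (x : SkorokhodSpace) {ε : ℝ} (hε : 0 < ε) :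
    ∃ v : FiniteVariation, ∀ t, |x t - v.toFun t| ≤ ε := by
  obtain ⟨G, hG, hclose⟩ := x.exists_isGraphBV_approx hε
  obtain ⟨v, hv⟩ := hG.exists_finiteVariation (GraphPath.refl x)
  refine ⟨v, fun t => ?_⟩
  rw [hv, abs_sub_comm]
  exact hclose _ (x.mk_mem_completedGraph t)

theorem IsGraphMonotone.exists_measure {H : ℝ × I → ℝ} (hH : IsGraphMonotone x H)
    (P : GraphPath x) : ∃ (μ : Measure I) (_ : IsFiniteMeasure μ),
      ∀ t, μ.real (Iic t) = H (P.toFun t) := by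
  obtain ⟨μ, h, h'⟩ := exists_measure_real_Iic_eq (hH.monotone_comp P) (hH.rightContinuous P)
    fun t => hH.nonneg _
  exact ⟨μ, h, h'⟩

/-- The measures with distribution functions `H (P n ·)` have the same mass `H (x 1, 1)`. Outside
the exceptional times of `H` the distribution functions are eventually constant in `n`. -/
theorem IsGraphMonotone.tendsto_integral {H : ℝ × I → ℝ} (hH : IsGraphMonotone x H)
    {P : ℕ → GraphPath x} (hP : ∀ t, Tendsto (fun n => ((P n).toFun t).2) atTop (𝓝 t))
    {μ : ℕ → Measure I} {ν : Measure I} [∀ n, IsFiniteMeasure (μ n)] [IsFiniteMeasure ν]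
    (hμ : ∀ n t, (μ n).real (Iic t) = H ((P n).toFun t)) (hν : ∀ t, ν.real (Iic t) = H (x t, t))
    (f : C(I, ℝ)) : Tendsto (fun n => ∫ t, f t ∂(μ n)) atTop (𝓝 (∫ t, f t ∂ν)) := by
  obtain ⟨F, hF, hconst⟩ := hH.locallyConst
  refine tendsto_integral_of_tendsto_cdf (fun n => ?_) hF (fun t ht => ?_) f
  · have : (univ : Set I) = Iic 1 := (Iic_top (α := I)).symm
    rw [this, hμ, hν, (P n).map_one]
  · simp_rw [hμ, hν]
    refine tendsto_const_nhds.congr' ?_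
    filter_upwards [(hP t).eventually (hconst t ht)] with n hn
    exact (hn (x t) ((P n).toFun t).1).symm

theorem IsGraphBV.weakStarConv {G : ℝ × I → ℝ} (hG : IsGraphBV x G)
    {P : ℕ → GraphPath x} (hP : ∀ t, Tendsto (fun n => ((P n).toFun t).2) atTop (𝓝 t))
    {v : ℕ → FiniteVariation} {v₀ : FiniteVariation}
    (hv : ∀ n t, (v n).toFun t = G ((P n).toFun t)) (hv₀ : ∀ t, v₀.toFun t = G (x t, t)) :
    FiniteVariation.WeakStarConv v v₀ := by
  obtain ⟨H, H', hH, hH', hG⟩ := hG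
  intro f
  choose μ hμ hμ' using fun n => hH.exists_measure (P n)
  choose ν hν hν' using fun n => hH'.exists_measure (P n)
  obtain ⟨μ₀, hμ₀, hμ₀'⟩ := hH.exists_measure (GraphPath.refl x)
  obtain ⟨ν₀, hν₀, hν₀'⟩ := hH'.exists_measure (GraphPath.refl x)
  have h1 : ∀ n, (v n).integral f = ∫ t, f t ∂(μ n) - ∫ t, f t ∂(ν n) := fun n =>
    FiniteVariation.integral_eq_sub (FiniteVariation.measure_eq_sub fun t => by
      rw [hμ', hν', hv, hG]) f
  have h2 : v₀.integral f = ∫ t, f t ∂μ₀ - ∫ t, f t ∂ν₀ :=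
    FiniteVariation.integral_eq_sub (FiniteVariation.measure_eq_sub fun t => by
      rw [hμ₀', hν₀', hv₀, hG]; rfl) f
  simp_rw [h1, h2]
  exact (hH.tendsto_integral hP hμ' hμ₀' f).sub (hH'.tendsto_integral hP hν' hν₀' f)

/-- How far the graph of `y` is from the right-continuous nondecreasing paths in the completed graph
of `x`. The matching of the two graphs is one-sided: the path may leave out parts of the completed
graph of `x`, and `y` enters only through the points `(y t, t)`. -/
noncomputable def shadowDist (x y : SkorokhodSpace) : ℝ≥0∞ :=
  ⨅ P : GraphPath x, ⨆ t, edist (P.toFun t) (y t, t)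

/-- The approximations of `y n` are `G ∘ P n`, where `G` is a function of finite variation on the
completed graph of `x` close to the first coordinate, and `P n` a path in that graph close to the
graph of `y n`. -/
theorem sConv_of_tendsto_shadowDist {y : ℕ → SkorokhodSpace}
    (h : Tendsto (fun n => shadowDist x (y n)) atTop (𝓝 0)) : SConv y x := by
  have hex : ∀ n : ℕ, ∃ P : GraphPath x,
      ⨆ t, edist (P.toFun t) (y n t, t) ≤ shadowDist x (y n) + ((n : ℝ≥0∞) + 1)⁻¹ := by
    intro n
    by_cases htop : shadowDist x (y n) = ⊤
    · exact ⟨GraphPath.refl x, by simp [htop]⟩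
    · obtain ⟨P, hP⟩ := iInf_lt_iff.1 (ENNReal.lt_add_right htop
        (ENNReal.inv_ne_zero.2 (by finiteness : (n : ℝ≥0∞) + 1 ≠ ⊤)))
      exact ⟨P, hP.le⟩
  choose P hP using hex
  have hlim : Tendsto (fun n => ⨆ t, edist ((P n).toFun t) (y n t, t)) atTop (𝓝 0) := by
    refine tendsto_of_tendsto_of_tendsto_of_le_of_le tendsto_const_nhds ?_ (fun _ => zero_le)
      hP
    have h1 : Tendsto (fun n : ℕ => ((n : ℝ≥0∞) + 1)⁻¹) atTop (𝓝 0) := by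
      have := (tendsto_add_atTop_iff_nat 1).2 ENNReal.tendsto_inv_nat_nhds_zero
      simpa using this
    simpa using h.add h1
  have htime : ∀ t, Tendsto (fun n => ((P n).toFun t).2) atTop (𝓝 t) := by
    intro t
    rw [tendsto_iff_edist_tendsto_0]
    refine tendsto_of_tendsto_of_tendsto_of_le_of_le tendsto_const_nhds hlim (fun _ => zero_le)
      fun n => ?_
    exact (le_max_right _ _).trans (le_iSup (fun t => edist ((P n).toFun t) (y n t, t)) t)
  intro ε hε
  obtain ⟨G, hG, hclose⟩ := x.exists_isGraphBV_approx (half_pos hε)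
  choose w hw using fun n => hG.exists_finiteVariation (P n)
  obtain ⟨v₀, hv₀⟩ := hG.exists_finiteVariation (GraphPath.refl x)
  choose w' hw' using fun n => (y n).exists_finiteVariation_approx hε
  classical
  -- For the finitely many `n` for which `P n` is not yet close enough to the graph of `y n`,
  -- any approximation of `y n` will do.
  refine ⟨fun n => if ⨆ t, edist ((P n).toFun t) (y n t, t) ≤ ENNReal.ofReal (ε / 2) then w n
    else w' n, v₀, fun n t => ?_, fun t => ?_, fun f => ?_⟩
  · dsimp only
    split_ifs with hn
    · have h1 := (le_max_left _ _).trans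
        ((le_iSup (fun t => edist ((P n).toFun t) (y n t, t)) t).trans hn)
      rw [edist_dist, ENNReal.ofReal_le_ofReal_iff (half_pos hε).le, Real.dist_eq] at h1
      have h2 := hclose _ ((P n).mem t)
      rw [hw]
      simp only at h1
      rw [abs_le] at *
      constructor <;> linarith [h1.1, h1.2, h2.1, h2.2]
    · exact hw' n t
  · rw [hv₀, abs_sub_comm]
    exact (hclose _ (x.mk_mem_completedGraph t)).trans (by linarith)
  · refine (hG.weakStarConv htime hw hv₀ f).congr' ?_
    filter_upwards [hlim.eventually_le_const (ENNReal.ofReal_pos.2 (half_pos hε))] with n hn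
    rw [if_pos hn]

/-! ### Comparison with the `J₁` and `M₁` distances -/

theorem shadowDist_le_j1Dist (x y : SkorokhodSpace) : shadowDist x y ≤ j1Dist x y := by
  refine le_iInf fun l => ?_
  let P : GraphPath x :=
    { toFun := fun t => (x (l.symm t), l.symm t)
      mem := fun t => x.mk_mem_completedGraph _
      mono := fun s s' h => (GraphPath.refl x).mono _ _ (l.symm.monotone h)
      rightContinuous := fun t =>
        ((GraphPath.refl x).rightContinuous (l.symm t)).comp
          l.symm.continuous.continuousWithinAt fun s hs => l.symm.monotone hs
      map_one := by rw [show l.symm (1 : I) = 1 from l.symm.map_top] }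
  refine (iInf_le _ P).trans (iSup_le fun t => ?_)
  obtain ⟨s, rfl⟩ := l.surjective t
  change max (edist (x (l.symm (l s))) (y (l s))) (edist (l.symm (l s)) (l s)) ≤ _
  rw [l.symm_apply_apply, max_comm, edist_comm s]
  exact max_le_max (le_iSup (fun t => edist (l t) t) s)
    (le_iSup (fun t => edist (x t) (y (l t))) s)

theorem m1Dist_comm (x y : SkorokhodSpace) : m1Dist x y = m1Dist y x := by
  have : ∀ x y, m1Dist x y ≤ m1Dist y x := fun x y => by
    refine le_iInf₂ fun φ hφ => le_iInf₂ fun ψ hψ => ?_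
    refine (iInf₂_le ψ hψ).trans ((iInf₂_le φ hφ).trans ?_)
    simp_rw [edist_comm (ψ _), le_refl]
  exact le_antisymm (this x y) (this y x)

theorem map_one_of_mem_parametricReps {φ : I → ℝ × I} (hφ : φ ∈ parametricReps x) :
    φ 1 = (x 1, 1) := by
  obtain ⟨s, hs⟩ := hφ.2.1.symm ▸ x.mk_mem_completedGraph 1
  refine eq_mk_of_graphLE (hφ.2.1 ▸ mem_range_self 1) ?_ unitInterval.le_one'
  rw [← hs]
  exact hφ.2.2 s 1 unitInterval.le_one'

/-- The last parameter at which a parametric representation is at a time at most `t`. -/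
noncomputable def lastParam (φ : I → ℝ × I) (t : I) : I := sSup {s | (φ s).2 ≤ t}

theorem time_le_of_mem_parametricReps {φ : I → ℝ × I} (hφ : φ ∈ parametricReps x) {s s' : I}
    (h : s ≤ s') : (φ s).2 ≤ (φ s').2 :=
  (hφ.2.2 s s' h).elim le_of_lt fun h => h.1.le

theorem apply_lastParam {φ : I → ℝ × I} (hφ : φ ∈ parametricReps x) (t : I) :
    φ (lastParam φ t) = (x t, t) := by
  obtain ⟨s, hs⟩ := hφ.2.1.symm ▸ x.mk_mem_completedGraph t
  have hmem : s ∈ {s | (φ s).2 ≤ t} := by simp [hs]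
  have hcl : IsClosed {s | (φ s).2 ≤ t} :=
    isClosed_le (continuous_snd.comp hφ.1) continuous_const
  have hlast : lastParam φ t ∈ {s | (φ s).2 ≤ t} := hcl.csSup_mem ⟨s, hmem⟩ (OrderTop.bddAbove _)
  refine eq_mk_of_graphLE (hφ.2.1 ▸ mem_range_self _) ?_ hlast
  rw [← hs]
  exact hφ.2.2 s _ (le_sSup hmem)

theorem monotone_lastParam (φ : I → ℝ × I) : Monotone (lastParam φ) :=
  fun _ _ h => sSup_le_sSup fun _ hs => le_trans hs h

theorem continuousWithinAt_lastParam {φ : I → ℝ × I} (hφ : φ ∈ parametricReps x) (t : I) :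
    ContinuousWithinAt (lastParam φ) (Ici t) t := by
  refine tendsto_order.2 ⟨fun a ha => ?_, fun a ha => ?_⟩
  · filter_upwards [self_mem_nhdsWithin] with u hu
    exact ha.trans_le (monotone_lastParam φ hu)
  · obtain ⟨b, hb, hba⟩ := exists_between ha
    have hlt : t < (φ b).2 := by
      by_contra! h
      have hle : b ≤ lastParam φ t := le_sSup h
      exact absurd hle (not_le.2 hb)
    filter_upwards [Ico_mem_nhdsGE hlt] with u hu
    refine lt_of_le_of_lt (sSup_le fun s hs => ?_) hba
    by_contra hsb
    exact absurd ((time_le_of_mem_parametricReps hφ (not_le.1 hsb).le).trans hs) (not_le.2 hu.2)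

theorem shadowDist_le_m1Dist (x y : SkorokhodSpace) : shadowDist x y ≤ m1Dist x y := by
  refine le_iInf₂ fun ψ hψ => le_iInf₂ fun φ hφ => ?_
  let P : GraphPath x :=
    { toFun := fun t => ψ (lastParam φ t)
      mem := fun t => hψ.2.1 ▸ mem_range_self _
      mono := fun s s' h => hψ.2.2 _ _ (monotone_lastParam φ h)
      rightContinuous := fun t =>
        hψ.1.continuousAt.comp_continuousWithinAt (continuousWithinAt_lastParam hφ t)
      map_one := by
        have h1 : lastParam φ 1 = 1 :=
          le_antisymm unitInterval.le_one'
            (le_sSup (show (1 : I) ∈ {s | (φ s).2 ≤ 1} from unitInterval.le_one'))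
        rw [h1, map_one_of_mem_parametricReps hψ] }
  refine (iInf_le _ P).trans (iSup_le fun t => ?_)
  change edist (ψ (lastParam φ t)) (y t, t) ≤ _
  rw [← apply_lastParam hφ t]
  exact le_iSup (fun s => edist (ψ s) (φ s)) (lastParam φ t)

theorem topologyOfDist_le_sTopology {d : SkorokhodSpace → SkorokhodSpace → ℝ≥0∞}
    (hd : ∀ x y, shadowDist x y ≤ d x y) : topologyOfDist d ≤ sTopology := by
  intro U hU x hx
  by_contra! hne
  have hex : ∀ n : ℕ, ∃ y, d x y < ((n : ℝ≥0∞) + 1)⁻¹ ∧ y ∉ U := fun n =>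
    hne _ (ENNReal.inv_pos.2 (by finiteness))
  choose y hy hyU using hex
  have hconv : SConv y x := by
    refine sConv_of_tendsto_shadowDist (tendsto_of_tendsto_of_tendsto_of_le_of_le
      tendsto_const_nhds ?_ (fun _ => zero_le) fun n => (hd x (y n)).trans (hy n).le)
    have := (tendsto_add_atTop_iff_nat 1).2 ENNReal.tendsto_inv_nat_nhds_zero
    simpa using this
  obtain ⟨n, hn⟩ := (hU y x hconv hx).exists
  exact hyU n hn

theorem M1Conv.sConv {y : ℕ → SkorokhodSpace} (h : M1Conv y x) : SConv y x :=
  sConv_of_tendsto_shadowDist (tendsto_of_tendsto_of_tendsto_of_le_of_le tendsto_const_nhds h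
    (fun _ => zero_le) fun n => (shadowDist_le_m1Dist x (y n)).trans (m1Dist_comm x (y n)).le)

/-! ### Uniqueness of limits and compactness -/

theorem SConv.comp {y : ℕ → SkorokhodSpace} (h : SConv y x) {k : ℕ → ℕ}
    (hk : Tendsto k atTop atTop) : SConv (fun n => y (k n)) x := fun ε hε => by
  obtain ⟨v, v₀, h1, h2, h3⟩ := h ε hε
  exact ⟨fun n => v (k n), v₀, fun n => h1 (k n), h2, fun f => (h3 f).comp hk⟩

/-- Uniform one-sided bounds on differences persist under weak-* convergence: integrating by parts,
they persist for the averages over small intervals `[t, t + δ]`. -/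
theorem FiniteVariation.WeakStarConv.sub_le {v w : ℕ → FiniteVariation} {v₀ w₀ : FiniteVariation}
    (hv : WeakStarConv v v₀) (hw : WeakStarConv w w₀) {c : ℝ}
    (h : ∀ n t, (v n).toFun t - (w n).toFun t ≤ c) (t : I) : v₀.toFun t - w₀.toFun t ≤ c := by
  rcases eq_or_ne t 1 with rfl | ht
  · refine le_of_tendsto ((hv (ContinuousMap.const I 1)).sub (hw (ContinuousMap.const I 1))
      |>.congr fun n => ?_) (Eventually.of_forall fun n => h n 1) |>.trans_eq' ?_
    · rw [FiniteVariation.integral_one, FiniteVariation.integral_one]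
    · rw [FiniteVariation.integral_one, FiniteVariation.integral_one]
  have ht1 : t < 1 := lt_of_le_of_ne unitInterval.le_one' ht
  by_contra! hlt
  obtain ⟨c', hc, hc'⟩ := exists_between hlt
  have hr := (v₀.rightContinuous t).sub (w₀.rightContinuous t)
  obtain ⟨b', hb', hsub'⟩ :=
    (mem_nhdsGE_iff_exists_Ico_subset' ht1).1 (hr.eventually_const_lt hc')
  obtain ⟨b, hb, hbb'⟩ := exists_between (show t < b' from hb')
  have hsub := (Icc_subset_Ico_right hbb').trans hsub'
  have hab : (t : ℝ) < b := hb
  have hav : ∀ (v' w' : FiniteVariation), v'.integral (ramp t b) - w'.integral (ramp t b) =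
      ∫ u in (t : ℝ)..b, (v'.toFun (projIcc 0 1 zero_le_one u) -
        w'.toFun (projIcc 0 1 zero_le_one u)) := fun v' w' => by
    rw [v'.integral_ramp t.2.1 hab.le b.2.2, w'.integral_ramp t.2.1 hab.le b.2.2,
      intervalIntegral.integral_sub v'.intervalIntegrable w'.intervalIntegrable]
  have hupper : v₀.integral (ramp t b) - w₀.integral (ramp t b) ≤ c * (b - t) := by
    refine le_of_tendsto ((hv (ramp t b)).sub (hw (ramp t b))) (Eventually.of_forall fun n => ?_)
    rw [hav]
    refine (intervalIntegral.integral_mono_on hab.le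
      ((v n).intervalIntegrable.sub (w n).intervalIntegrable) intervalIntegrable_const
      (fun u _ => h n _)).trans_eq ?_
    rw [intervalIntegral.integral_const, smul_eq_mul, mul_comm]
  have hlower : c' * (b - t) ≤ v₀.integral (ramp t b) - w₀.integral (ramp t b) := by
    rw [hav]
    refine le_trans (le_of_eq ?_) (intervalIntegral.integral_mono_on hab.le
      intervalIntegrable_const (v₀.intervalIntegrable.sub w₀.intervalIntegrable)
      (f := fun _ => c') (fun u hu => ?_))
    · rw [intervalIntegral.integral_const, smul_eq_mul, mul_comm]
    · have hu' : u ∈ Icc (0 : ℝ) 1 := ⟨t.2.1.trans hu.1, hu.2.trans b.2.2⟩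
      rw [projIcc_of_mem zero_le_one hu']
      exact le_of_lt (hsub (show (⟨u, hu'⟩ : I) ∈ Icc t b from hu))
  nlinarith

theorem SConv.unique {y : ℕ → SkorokhodSpace} {x₁ x₂ : SkorokhodSpace} (h₁ : SConv y x₁)
    (h₂ : SConv y x₂) : x₁ = x₂ := by
  have key : ∀ {x₁ x₂ : SkorokhodSpace}, SConv y x₁ → SConv y x₂ → ∀ t, x₁ t ≤ x₂ t := by
    intro x₁ x₂ h₁ h₂ t
    refine le_of_forall_pos_le_add fun ε hε => ?_
    obtain ⟨v, v₀, hv, hv₀, hvc⟩ := h₁ (ε / 4) (by positivity)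
    obtain ⟨w, w₀, hw, hw₀, hwc⟩ := h₂ (ε / 4) (by positivity)
    have := hvc.sub_le hwc (c := ε / 2) (fun n s => by
      have h1 := abs_le.1 (hv n s)
      have h2 := abs_le.1 (hw n s)
      linarith [h1.1, h2.2]) t
    have h1 := abs_le.1 (hv₀ t)
    have h2 := abs_le.1 (hw₀ t)
    linarith [h1.2, h2.1]
  exact SkorokhodSpace.ext (funext fun t => le_antisymm (key h₁ h₂ t) (key h₂ h₁ t))

theorem sConv_const (x : SkorokhodSpace) : SConv (fun _ => x) x := fun ε hε => by
  obtain ⟨v, hv⟩ := x.exists_finiteVariation_approx hε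
  exact ⟨fun _ => v, v, fun _ => hv, hv, fun f => tendsto_const_nhds⟩

/-- A set is `S`-closed if it contains the limits of its `S`-convergent sequences. -/
theorem isClosed_sTopology_of_forall_sConv {C : Set SkorokhodSpace}
    (h : ∀ y z, (∀ n, y n ∈ C) → SConv y z → z ∈ C) : IsClosed[sTopology] C := by
  refine @IsClosed.mk _ sTopology _ fun y z hyz hz => ?_
  by_contra hne
  obtain ⟨k, hk, hkC⟩ := extraction_of_frequently_atTop (not_eventually.1 hne)
  exact hz (h _ z (fun n => not_not.1 (hkC n)) (hyz.comp hk.tendsto_atTop))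

/-- A value taken infinitely often by an `S`-convergent sequence is its limit. -/
theorem SConv.eq_of_frequently_eq {y : ℕ → SkorokhodSpace} (h : SConv y x) {c : SkorokhodSpace}
    (hc : ∃ᶠ n in atTop, y n = c) : c = x := by
  obtain ⟨k, hk, hkc⟩ := extraction_of_frequently_atTop hc
  have h1 := h.comp hk.tendsto_atTop
  simp_rw [hkc] at h1
  exact (sConv_const c).unique h1

/-- A tail of an `S`-convergent sequence, together with its limit, is `S`-closed. -/
theorem isClosed_insert_tail {y : ℕ → SkorokhodSpace} (h : SConv y x) (N : ℕ) :
    IsClosed[sTopology] (insert x (y '' Ici N)) := by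
  refine isClosed_sTopology_of_forall_sConv fun u z hu huz => ?_
  by_cases hfreq : ∃ c ∈ insert x (y '' Ici N), ∃ᶠ m in atTop, u m = c
  · obtain ⟨c, hc, hc'⟩ := hfreq
    rwa [← huz.eq_of_frequently_eq hc']
  -- Otherwise `u` is eventually of the form `y ∘ k` with `k` tending to infinity.
  · have hne : ∀ c ∈ insert x (y '' Ici N), ∀ᶠ m in atTop, u m ≠ c := fun c hc =>
      not_frequently.1 fun hf => hfreq ⟨c, hc, hf⟩
    obtain ⟨M, hM⟩ := eventually_atTop.1 (hne x (mem_insert _ _))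
    have hex : ∀ m, ∃ j ≥ N, y j = u (m + M) := fun m =>
      (hu (m + M)).resolve_left (hM _ (Nat.le_add_left M m))
    choose k hkN hk using hex
    have hshift : Tendsto (fun m => m + M) atTop atTop := tendsto_add_atTop_nat M
    have hktop : Tendsto k atTop atTop := by
      refine tendsto_atTop.2 fun b => ?_
      have : ∀ j ∈ Finset.Ico N b, ∀ᶠ m in atTop, u (m + M) ≠ y j := fun j hj =>
        hshift.eventually (hne _ (mem_insert_of_mem _ ⟨j, (Finset.mem_Ico.1 hj).1, rfl⟩))
      filter_upwards [(Finset.eventually_all _).2 this] with m hm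
      by_contra! hlt
      exact hm (k m) (Finset.mem_Ico.2 ⟨hkN m, hlt⟩) (hk m).symm
    have h1 := h.comp hktop
    simp_rw [hk] at h1
    exact Or.inl ((huz.comp hshift).unique h1)

/-- The compact set meets the closed tails of a convergent sequence of its points, hence their
intersection, and this consists of the limit only. -/
theorem isClosed_sTopology_of_isCompact {K : Set SkorokhodSpace}
    (hK : @IsCompact _ sTopology K) : IsClosed[sTopology] K := by
  refine isClosed_sTopology_of_forall_sConv fun y z hy hyz => ?_
  obtain ⟨c, hcK, hc⟩ := @IsCompact.inter_iInter_nonempty _ sTopology _ _ hK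
    (fun N => insert z (y '' Ici N)) (isClosed_insert_tail hyz) fun s =>
      ⟨y (s.sup id), hy _, mem_iInter₂.2 fun N hN =>
        mem_insert_of_mem _ ⟨_, Finset.le_sup (f := id) hN, rfl⟩⟩
  rw [mem_iInter] at hc
  by_cases h : c = z
  · rwa [← h]
  · have hfreq : ∃ᶠ n in atTop, y n = c := frequently_atTop.2 fun N => (hc N).resolve_left h
    exact absurd (hyz.eq_of_frequently_eq hfreq) h

theorem isRelCompact_sTopology_of_m1Topology {A : Set SkorokhodSpace}
    (h : IsRelCompact m1Topology A) : IsRelCompact sTopology A := by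
  have hle : m1Topology ≤ sTopology := topologyOfDist_le_sTopology shadowDist_le_m1Dist
  have hK : @IsCompact _ sTopology (@closure _ m1Topology A) := by
    simpa using @IsCompact.image _ _ m1Topology sTopology _ _ h (continuous_id_of_le hle)
  refine @IsCompact.of_isClosed_subset _ sTopology _ _ hK (@isClosed_closure _ sTopology A) ?_
  exact @closure_minimal _ sTopology _ _ (@subset_closure _ m1Topology A)
    (isClosed_sTopology_of_isCompact hK)

end SkorokhodSpace

/-- In the order on topologies, `τ ≤ σ` means that every `σ`-open set is `τ`-open. -/
theorem mainTheorem3 :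
    SkorokhodSpace.m1Topology ≤ SkorokhodSpace.sTopology ∧
    SkorokhodSpace.j1Topology ≤ SkorokhodSpace.sTopology ∧
    ∀ A : Set SkorokhodSpace,
      (SkorokhodSpace.IsRelCompact SkorokhodSpace.m1Topology A →
        SkorokhodSpace.IsRelCompact SkorokhodSpace.sTopology A) ∧
      (SkorokhodSpace.IsRelSeqCompact SkorokhodSpace.M1Conv A →
        SkorokhodSpace.IsRelSeqCompact SkorokhodSpace.SConv A) := by
  refine ⟨SkorokhodSpace.topologyOfDist_le_sTopology SkorokhodSpace.shadowDist_le_m1Dist,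
    SkorokhodSpace.topologyOfDist_le_sTopology SkorokhodSpace.shadowDist_le_j1Dist,
    fun A => ⟨SkorokhodSpace.isRelCompact_sTopology_of_m1Topology, fun h x hx => ?_⟩⟩
  obtain ⟨k, hk, x₀, hconv⟩ := h x hx
  exact ⟨k, hk, x₀, hconv.sConv⟩
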